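/- Let $\mathbb K$ be $\mathbb R$ or $\mathbb C$. Consider a linear system over $\mathbb K$ decomposed into $p$ nonoverlapping subdomains joined by an interface $\Gamma$: for $i\in\{1,\dots,p\}$ let $A_{II}^{(i)}, A_{I\Gamma}^{(i)}, A_{\Gamma I}^{(i)}, A_{\Gamma\Gamma}^{(i)}$ be matrices and $b_I^{(i)}, b_\Gamma^{(i)}$ vectors, and let \[ A=\begin{bmatrix}A_{II}^{(1)}&&0&A_{I\Gamma}^{(1)}\\&\ddots&&\vdots\\0&&A_{II}^{(p)}&A_{I\Gamma}^{(p)}\\A_{\Gamma I}^{(1)}&\cdots&A_{\Gamma I}^{(p)}&A_{\Gamma\Gamma}\end{bmatrix},\qquad A_{\Gamma\Gamma}=\sum_{i=1}^p A_{\Gamma\Gamma}^{(i)}, \] \[ S^{(i)}=A_{\Gamma\Gamma}^{(i)}-A_{\Gamma I}^{(i)}\bigl(A_{II}^{(i)}\bigr)^{-1}A_{I\Gamma}^{(i)},\qquad d^{(i)}=b_\Gamma^{(i)}-A_{\Gamma I}^{(i)}\bigl(A_{II}^{(i)}\bigr)^{-1}b_I^{(i)}. \] Let $I^{(1)},\dots,I^{(p)}$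 be matrices on $\Gamma$ with $\sum_i I^{(i)}=I_{\Gamma\Gamma}$, the identity, and let $M_{\Gamma\Gamma}$ be a nonsingular matrix on $\Gamma$. The asynchronous primal Schur method is the iteration, for $k=0,1,2,\dots$ and $i\in\{1,\dots,p\}$, \[ y^{(i),k}=I^{(i)}x^{(i),k}+M_{\Gamma\Gamma}^{-1}\bigl(d^{(i)}-S^{(i)}x^{(i),k}\bigr),\qquad x^{(i),k+1}=\begin{cases}\sum_{j=1}^p y^{(j),\tau^i_j(k)}& i\in P^{(k)},\\ x^{(i),k}& i\notin P^{(k)},\end{cases} \] where $P^{(k)}\subseteq\{1,\dots,p\}$, each $i$ belongs to $P^{(k)}$ for infinitely many $k$, $\tau^i_j(k)\in\{0,\dots,k\}$, and $\tau^i_j(k)\to\infty$ as $k\to\infty$ for all $i,j$. The method is called convergent if the interface problem $\bigl(\sum_i S^{(i)}\bigr)x=\sum_i d^{(i)}$ has a unique solution $x^*$ and, for all such $P^{(k)},\tau^i_j$ and all initial vectors $x^{(1),0},\dots,x^{(p),0}$, one has $x^{(i),k}\to x^*$ as $k\to\infty$ for every $i$. For a matrix $B$ let $|B|$ be its entrywise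 absolute value and, for $B$ square, let the comparison matrix $\langle B\rangle$ have entries $|b_{ii}|$ on the diagonal and $-|b_{ij}|$ for $i\neq j$. A real square matrix $B$ is an M-matrix if there is a real $\beta$ with $\beta I-B\ge 0$ entrywise and $\beta>\rho(\beta I-B)$, where $\rho$ is the spectral radius; $B$ is an H-matrix if $\langle B\rangle$ is an M-matrix. Assume that there are real matrices $W^{(i)}\ge0$ (entrywise) such that $A_{\Gamma\Gamma}^{(i)}=W^{(i)}\circ A_{\Gamma\Gamma}$ and $I^{(i)}=W^{(i)}\circ I_{\Gamma\Gamma}$ for all $i$, where $\circ$ is the entrywise product, and that $A$ is an H-matrix. Then all $A_{II}^{(i)}$ are nonsingular, and: 1. If $M_{\Gamma\Gamma}$ is diagonal and $\langle M_{\Gamma\Gamma}\rangle-|M_{\Gamma\Gamma}-A_{\Gamma\Gamma}|=\langle A_{\Gamma\Gamma}\rangle$, then $M_{\Gamma\Gamma}$ is nonsingular and the asynchronous primal Schur method is convergent. 2. For every real $\alpha\ge1$, the matrix $M_{\Gamma\Gamma}=\alpha\operatorname{diag}A_{\Gamma\Gamma}$ (the diagonal part of $A_{\Gamma\Gamma}$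 times $\alpha$) satisfies the hypotheses of 1, so that the method with this choice is convergent. -/

import Mathlib

open Filter Topology Matrix
open scoped ENNReal

namespace AsyncSchur

noncomputable section

/-- Spectral radius of a real square matrix: the largest modulus of its complex eigenvalues. -/
def rho {n : Type*} [Fintype n] [DecidableEq n] (B : Matrix n n ℝ) : ℝ≥0∞ :=
  spectralRadius ℂ (B.map (fun t : ℝ => (t : ℂ)))

/-- `B` is an M-matrix: for some real `α`, `α I - B ≥ 0` entrywise and `α > ρ(α I - B)`. -/
def IsMMatrix {n : Type*} [Fintype n] [DecidableEq n] (B : Matrix n n ℝ) : Prop :=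
  ∃ α : ℝ, (∀ i j, 0 ≤ (α • (1 : Matrix n n ℝ) - B) i j) ∧
    rho (α • (1 : Matrix n n ℝ) - B) < ENNReal.ofReal α

/-- Entrywise absolute value. -/
def absMatrix {m n 𝕜 : Type*} [RCLike 𝕜] (B : Matrix m n 𝕜) : Matrix m n ℝ :=
  B.map (fun z => ‖z‖)

/-- The comparison matrix `⟨B⟩`. -/
def comparison {n 𝕜 : Type*} [DecidableEq n] [RCLike 𝕜] (B : Matrix n n 𝕜) : Matrix n n ℝ :=
  Matrix.of fun i j => if i = j then ‖B i j‖ else -‖B i j‖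

/-- `B` is an H-matrix: its comparison matrix is an M-matrix. -/
def IsHMatrix {n 𝕜 : Type*} [Fintype n] [DecidableEq n] [RCLike 𝕜] (B : Matrix n n 𝕜) : Prop :=
  IsMMatrix (comparison B)

/-- The local matrices and right-hand sides of a linear system that is decomposed into
nonoverlapping subdomains `i : ι` with interiors `N i`, joined by an interface `Γ`. -/
structure DDSystem (𝕜 ι : Type*) (N : ι → Type*) (Γ : Type*) where
  AII : ∀ i, Matrix (N i) (N i) 𝕜
  AIΓ : ∀ i, Matrix (N i) Γ 𝕜
  AΓI : ∀ i, Matrix Γ (N i) 𝕜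
  AΓΓ : ι → Matrix Γ Γ 𝕜
  bI : ∀ i, N i → 𝕜
  bΓ : ι → Γ → 𝕜

namespace DDSystem

variable {𝕜 ι Γ : Type*} {N : ι → Type*} [RCLike 𝕜] [Fintype ι] [DecidableEq ι]
  [∀ i, Fintype (N i)] [∀ i, DecidableEq (N i)] [Fintype Γ] [DecidableEq Γ]

/-- The assembled interface block `A_ΓΓ = ∑ i, A_ΓΓ^(i)`. -/
def interfaceBlock (D : DDSystem 𝕜 ι N Γ) : Matrix Γ Γ 𝕜 := ∑ i, D.AΓΓ i

/-- The global matrix `A`, with block-diagonal interior part `A_II^(i)`, last block column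
`A_IΓ^(i)`, last block row `A_ΓI^(i)` and corner block `A_ΓΓ`. -/
def globalMatrix (D : DDSystem 𝕜 ι N Γ) : Matrix ((Σ i, N i) ⊕ Γ) ((Σ i, N i) ⊕ Γ) 𝕜 :=
  Matrix.fromBlocks (Matrix.blockDiagonal' D.AII)
    (Matrix.of fun r g => D.AIΓ r.1 r.2 g)
    (Matrix.of fun g c => D.AΓI c.1 g c.2)
    D.interfaceBlock

/-- The local Schur complement `S^(i) = A_ΓΓ^(i) - A_ΓI^(i) (A_II^(i))⁻¹ A_IΓ^(i)`. -/
def localSchur (D : DDSystem 𝕜 ι N Γ) (i : ι) : Matrix Γ Γ 𝕜 :=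
  D.AΓΓ i - D.AΓI i * (D.AII i)⁻¹ * D.AIΓ i

/-- The local condensed right-hand side `d^(i) = b_Γ^(i) - A_ΓI^(i) (A_II^(i))⁻¹ b_I^(i)`. -/
def localRhs (D : DDSystem 𝕜 ι N Γ) (i : ι) : Γ → 𝕜 :=
  D.bΓ i - (D.AΓI i * (D.AII i)⁻¹) *ᵥ D.bI i

/-- `y^(i) = I^(i) x + M⁻¹ (d^(i) - S^(i) x)`, the vector sent out by process `i` whose current
interface vector is `x`; `E i` is the matrix `I^(i)`. -/
def message (D : DDSystem 𝕜 ι N Γ) (E : ι → Matrix Γ Γ 𝕜) (M : Matrix Γ Γ 𝕜) (i : ι)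
    (x : Γ → 𝕜) : Γ → 𝕜 :=
  E i *ᵥ x + M⁻¹ *ᵥ (D.localRhs i - D.localSchur i *ᵥ x)

/-- `x k i` is the interface vector of process `i` after `k` steps of the asynchronous primal Schur
method with update sets `P k` and delayed time labels `τ i j k`. -/
def IsAsyncIteration (D : DDSystem 𝕜 ι N Γ) (E : ι → Matrix Γ Γ 𝕜) (M : Matrix Γ Γ 𝕜)
    (P : ℕ → Set ι) (τ : ι → ι → ℕ → ℕ) (x : ℕ → ι → Γ → 𝕜) : Prop :=
  ∀ k i, (i ∈ P k → x (k + 1) i = ∑ j, D.message E M j (x (τ i j k) j)) ∧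
    (i ∉ P k → x (k + 1) i = x k i)

end DDSystem

/-- Admissible asynchronous schedules: no process reads a future value, every process is updated
infinitely often, and the time labels that are read tend to infinity. -/
def IsAdmissible {ι : Type*} (P : ℕ → Set ι) (τ : ι → ι → ℕ → ℕ) : Prop :=
  (∀ i j k, τ i j k ≤ k) ∧ (∀ i, {k | i ∈ P k}.Infinite) ∧ ∀ i j, Tendsto (τ i j) atTop atTop

/-- Convergence of the asynchronous primal Schur method: the interface problem
`(∑ i, S^(i)) x = ∑ i, d^(i)` has exactly one solution, and for every admissible schedule and all
initial vectors the interface vectors of all processes tend to it. -/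
def DDSystem.AsyncSchurConverges {𝕜 ι Γ : Type*} {N : ι → Type*} [RCLike 𝕜] [Fintype ι]
    [∀ i, Fintype (N i)] [∀ i, DecidableEq (N i)] [Fintype Γ] [DecidableEq Γ]
    (D : DDSystem 𝕜 ι N Γ) (E : ι → Matrix Γ Γ 𝕜) (M : Matrix Γ Γ 𝕜) : Prop :=
  ∃ xstar : Γ → 𝕜,
    (∀ z : Γ → 𝕜, (∑ i, D.localSchur i) *ᵥ z = ∑ i, D.localRhs i ↔ z = xstar) ∧
    ∀ (P : ℕ → Set ι) (τ : ι → ι → ℕ → ℕ) (x : ℕ → ι → Γ → 𝕜),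
      IsAdmissible P τ → D.IsAsyncIteration E M P τ x →
      ∀ i, Tendsto (fun k => x k i) atTop (𝓝 xstar)

end

end AsyncSchur

/-! Since the comparison matrix of A is an M-matrix, it maps some positive vector (u, w) to a
positive vector (`IsMMatrix.exists_pos_mulVec_pos`): weighted by u on the interiors and w on the
interface, A is strictly row dominant. On interior rows this makes each block invertible and, by a
maximum principle (`norm_le_of_norm_mulVec_le`), turns |z| ≤ c w into |AII⁻¹ AIΓ z| ≤ c u. For
diagonal M, the common weights give M E^(j) - S^(j) = W^(j) ∘ (M - A_ΓΓ) + AΓI AII⁻¹ AIΓ.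
Nonnegative weights summing to one wherever M - A_ΓΓ is nonzero off the diagonal, and on the
diagonal, mean that splitting over j costs nothing in the triangle inequality. The comparison
identity and interface dominance then make the update contract the w-weighted sup norm, jointly in
its separate and possibly outdated arguments. Such a contraction tolerates asynchrony
(`tendsto_zero_of_async_contraction`) and also forces the interface problem to be uniquely solvable.
-/

namespace AsyncSchur

/-! ### M-matrices and positive vectors -/

section PositiveVector

attribute [local instance] Matrix.linftyOpNormedRing Matrix.linftyOpNormedAlgebra

theorem matrix_pow_nonneg {n : Type*} [Fintype n] [DecidableEq n] {B : Matrix n n ℝ}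
    (hB : ∀ i j, 0 ≤ B i j) (m : ℕ) : ∀ i j, 0 ≤ (B ^ m) i j := by
  induction m with
  | zero =>
    intro i j
    rw [pow_zero, Matrix.one_apply]
    split_ifs <;> norm_num
  | succ m ih =>
    intro i j
    rw [pow_succ, Matrix.mul_apply]
    exact Finset.sum_nonneg fun k _ => mul_nonneg (ih i k) (hB k j)

/-- Some power of a matrix with spectral radius below `β` has all row sums below that power
of `β`. -/
theorem exists_pow_rowSum_lt {n : Type*} [Fintype n] [DecidableEq n] {B : Matrix n n ℝ} {β : ℝ}
    (hβ : rho B < ENNReal.ofReal β) :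
    ∃ m : ℕ, 0 < m ∧ ∀ i, ∑ j, (B ^ m) i j < β ^ m := by
  have hβ0 : 0 < β := ENNReal.ofReal_pos.1 (lt_of_le_of_lt zero_le hβ)
  set C : Matrix n n ℂ := B.map (fun t : ℝ => (t : ℂ)) with hC
  -- Gelfand's formula, in the maximum row sum norm chosen by the local instances.
  have hlim := spectrum.pow_nnnorm_pow_one_div_tendsto_nhds_spectralRadius C
  obtain ⟨m, hm, hm0⟩ :=
    ((hlim.eventually (gt_mem_nhds hβ)).and (eventually_gt_atTop 0)).exists
  refine ⟨m, hm0, fun i => ?_⟩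
  have hpow : C ^ m = (B ^ m).map (fun t : ℝ => (t : ℂ)) :=
    (map_pow (Complex.ofRealHom.mapMatrix (m := n)) B m).symm
  have hnorm : ‖C ^ m‖ < β ^ m := by
    have h1 : ((‖C ^ m‖₊ : ℝ≥0∞) ^ (1 / m : ℝ)) ^ (m : ℝ) < ENNReal.ofReal β ^ (m : ℝ) :=
      ENNReal.rpow_lt_rpow hm (by exact_mod_cast hm0)
    rw [← ENNReal.rpow_mul, one_div, inv_mul_cancel₀ (by exact_mod_cast hm0.ne'),
      ENNReal.rpow_one, ENNReal.rpow_natCast, ← ENNReal.ofReal_pow hβ0.le] at h1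
    rwa [← enorm_eq_nnnorm, ← ofReal_norm,
      ENNReal.ofReal_lt_ofReal_iff (pow_pos hβ0 m)] at h1
  refine lt_of_le_of_lt ?_ hnorm
  rw [hpow, Matrix.linfty_opNorm_def]
  have h2 : ∑ j, ‖((B ^ m).map (fun t : ℝ => (t : ℂ))) i j‖₊ ≤
      Finset.univ.sup fun i => ∑ j, ‖((B ^ m).map (fun t : ℝ => (t : ℂ))) i j‖₊ :=
    Finset.le_sup (f := fun i => ∑ j, ‖((B ^ m).map (fun t : ℝ => (t : ℂ))) i j‖₊)
      (Finset.mem_univ i)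
  refine le_trans ?_ (NNReal.coe_le_coe.2 h2)
  rw [NNReal.coe_sum]
  refine Finset.sum_le_sum fun j _ => ?_
  simpa using le_abs_self ((B ^ m) i j)

end PositiveVector

/-- An M-matrix maps some positive vector to a positive vector. -/
theorem IsMMatrix.exists_pos_mulVec_pos {n : Type*} [Fintype n] [DecidableEq n]
    {B : Matrix n n ℝ} (hB : IsMMatrix B) :
    ∃ u : n → ℝ, (∀ i, 0 < u i) ∧ ∀ i, 0 < (B *ᵥ u) i := by
  obtain ⟨β, hnn, hβ⟩ := hB
  have hβ0 : 0 < β := ENNReal.ofReal_pos.1 (lt_of_le_of_lt zero_le hβ)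
  obtain ⟨m, hm0, hm⟩ := exists_pow_rowSum_lt hβ
  set N : Matrix n n ℝ := β • (1 : Matrix n n ℝ) - B with hN
  have hcomm : Commute (β • (1 : Matrix n n ℝ)) N := (Commute.one_left N).smul_left β
  -- Truncated Neumann series: B G = β^m I - N^m, whose row sums are positive by the choice of m.
  -- Hence the witness G 1.
  have hgeom := hcomm.mul_geom_sum₂ m
  set G : Matrix n n ℝ := ∑ k ∈ Finset.range m, (β • (1 : Matrix n n ℝ)) ^ k * N ^ (m - 1 - k)
    with hG
  have hsub : β • (1 : Matrix n n ℝ) - N = B := by rw [hN]; abel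
  rw [hsub, smul_pow, one_pow] at hgeom
  refine ⟨G *ᵥ 1, fun i => ?_, fun i => ?_⟩
  · have hterm : ∀ k, ∀ i j, ((β • (1 : Matrix n n ℝ)) ^ k * N ^ (m - 1 - k)) i j
        = β ^ k * (N ^ (m - 1 - k)) i j := by
      intro k i j
      rw [smul_pow, one_pow, smul_mul_assoc, one_mul, Matrix.smul_apply, smul_eq_mul]
    have hnonneg : ∀ k ∈ Finset.range m, ∀ j,
        0 ≤ ((β • (1 : Matrix n n ℝ)) ^ k * N ^ (m - 1 - k)) i j := by
      intro k _ j
      rw [hterm]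
      exact mul_nonneg (pow_nonneg hβ0.le k) (matrix_pow_nonneg hnn _ i j)
    have hG0 : ∀ j, 0 ≤ G i j := by
      intro j
      rw [hG, Matrix.sum_apply]
      exact Finset.sum_nonneg fun k hk => hnonneg k hk j
    have hGii : 0 < G i i := by
      rw [hG, Matrix.sum_apply]
      refine Finset.sum_pos' (fun k hk => hnonneg k hk i)
        ⟨m - 1, Finset.mem_range.2 (by omega), ?_⟩
      rw [hterm, Nat.sub_self, pow_zero, Matrix.one_apply_eq, mul_one]
      exact pow_pos hβ0 _
    simp only [Matrix.mulVec, dotProduct, Pi.one_apply, mul_one]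
    exact Finset.sum_pos' (fun j _ => hG0 j) ⟨i, Finset.mem_univ i, hGii⟩
  · rw [Matrix.mulVec_mulVec, hgeom, Matrix.sub_mulVec, Matrix.smul_mulVec, Matrix.one_mulVec]
    have h := hm i
    simp only [Pi.sub_apply, Pi.smul_apply, Pi.one_apply, smul_eq_mul, mul_one, Matrix.mulVec,
      dotProduct]
    linarith

/-! ### Weighted diagonal dominance -/

theorem comparison_mulVec_apply {n 𝕜 : Type*} [Fintype n] [DecidableEq n] [RCLike 𝕜]
    (B : Matrix n n 𝕜) (u : n → ℝ) (i : n) :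
    (comparison B *ᵥ u) i = 2 * ‖B i i‖ * u i - ∑ j, ‖B i j‖ * u j := by
  have h : ∀ j, comparison B i j * u j
      = (if i = j then 2 * ‖B i j‖ * u j else 0) - ‖B i j‖ * u j := by
    intro j
    simp only [comparison, Matrix.of_apply]
    split_ifs <;> ring
  simp only [Matrix.mulVec, dotProduct]
  rw [Finset.sum_congr rfl fun j _ => h j, Finset.sum_sub_distrib, Finset.sum_ite_eq,
    if_pos (Finset.mem_univ i)]

/-- Weighted maximum principle for a generalized strictly diagonally dominant matrix. -/
theorem norm_le_of_norm_mulVec_le {n 𝕜 : Type*} [Fintype n] [RCLike 𝕜]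
    {B : Matrix n n 𝕜} {u b : n → ℝ} (hu : ∀ i, 0 < u i) (hb : ∀ i, 0 ≤ b i)
    (hB : ∀ i, ∑ j, ‖B i j‖ * u j + b i < 2 * ‖B i i‖ * u i)
    {c : ℝ} (hc : 0 ≤ c) {v : n → 𝕜} (hv : ∀ i, ‖(B *ᵥ v) i‖ ≤ c * b i) (i : n) :
    ‖v i‖ ≤ c * u i := by
  classical
  have : Nonempty n := ⟨i⟩
  -- In the row where the weighted modulus peaks at t, t > c would contradict dominance.
  obtain ⟨r, hr⟩ := Finite.exists_max fun j => ‖v j‖ / u j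
  set t := ‖v r‖ / u r with ht
  have hvt : ∀ j, ‖v j‖ ≤ t * u j := fun j => (div_le_iff₀ (hu j)).1 (hr j)
  have hvr : ‖v r‖ = t * u r := (div_mul_cancel₀ _ (hu r).ne').symm
  suffices htc : t ≤ c from (hvt i).trans (mul_le_mul_of_nonneg_right htc (hu i).le)
  by_contra! htc
  have ht0 : 0 < t := hc.trans_lt htc
  have hsplit : B r r * v r = (B *ᵥ v) r - ∑ j ∈ Finset.univ.erase r, B r j * v j := by
    simp only [Matrix.mulVec, dotProduct]
    rw [← Finset.add_sum_erase _ _ (Finset.mem_univ r)]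
    ring
  have h1 : ‖B r r‖ * (t * u r) ≤
      c * b r + ∑ j ∈ Finset.univ.erase r, ‖B r j‖ * (t * u j) := by
    rw [← hvr, ← norm_mul, hsplit]
    refine (norm_sub_le _ _).trans (add_le_add (hv r) ((norm_sum_le _ _).trans ?_))
    refine Finset.sum_le_sum fun j _ => ?_
    rw [norm_mul]
    exact mul_le_mul_of_nonneg_left (hvt j) (norm_nonneg _)
  have h2 : ∑ j ∈ Finset.univ.erase r, ‖B r j‖ * (t * u j)
      = t * ∑ j ∈ Finset.univ.erase r, ‖B r j‖ * u j := by
    rw [Finset.mul_sum]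
    exact Finset.sum_congr rfl fun j _ => by ring
  have h3 := hB r
  rw [← Finset.add_sum_erase _ _ (Finset.mem_univ r)] at h3
  have h4 : c * b r ≤ t * b r := mul_le_mul_of_nonneg_right htc.le (hb r)
  have h5 := mul_lt_mul_of_pos_left h3 ht0
  rw [h2] at h1
  linarith

/-- The maximum principle with c = 0 kills every kernel vector. -/
theorem isUnit_of_dominant {n 𝕜 : Type*} [Fintype n] [DecidableEq n] [RCLike 𝕜]
    {B : Matrix n n 𝕜} {u : n → ℝ} (hu : ∀ i, 0 < u i)
    (hB : ∀ i, ∑ j, ‖B i j‖ * u j < 2 * ‖B i i‖ * u i) : IsUnit B := by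
  rw [← Matrix.mulVec_injective_iff_isUnit]
  refine (injective_iff_map_eq_zero B.mulVecLin).2 fun v hv => funext fun i => ?_
  have h := norm_le_of_norm_mulVec_le hu (b := 0) (fun _ => le_rfl) (by simpa using hB)
    (c := 0) le_rfl (v := v) (fun i => by
      rw [show B *ᵥ v = 0 from hv]
      simp) i
  simpa using h

/-! ### Asynchronous contractions -/

/-- Asynchronous iterations of a weighted-supremum-norm contraction converge to zero. -/
theorem tendsto_zero_of_async_contraction {ι Γ 𝕜 : Type*} [Finite ι] [Finite Γ] [RCLike 𝕜]
    {F : (ι → Γ → 𝕜) → Γ → 𝕜} {w : Γ → ℝ} (hw : ∀ g, 0 < w g) {θ : ℝ} (hθ0 : 0 ≤ θ)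
    (hθ1 : θ < 1)
    (hF : ∀ (c : ℝ) (z : ι → Γ → 𝕜), 0 ≤ c → (∀ j g, ‖z j g‖ ≤ c * w g) →
      ∀ g, ‖F z g‖ ≤ θ * c * w g)
    {P : ℕ → Set ι} {τ : ι → ι → ℕ → ℕ} (hPτ : IsAdmissible P τ) {e : ℕ → ι → Γ → 𝕜}
    (he : ∀ k i, (i ∈ P k → e (k + 1) i = F fun j => e (τ i j k) j) ∧
      (i ∉ P k → e (k + 1) i = e k i)) (i : ι) :
    Tendsto (fun k => e k i) atTop (𝓝 0) := by
  obtain ⟨hτ, hP, hτlim⟩ := hPτ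
  obtain ⟨C, hC⟩ := Finite.exists_le fun p : ι × Γ => ‖e 0 p.1 p.2‖ / w p.2
  have hC' : ∀ i g, ‖e 0 i g‖ ≤ max C 0 * w g := fun i g =>
    (div_le_iff₀ (hw g)).1 ((hC (i, g)).trans (le_max_left _ _))
  have hC0 : 0 ≤ max C 0 := le_max_right _ _
  generalize max C 0 = C₀ at hC' hC0
  -- Nested boxes: from some time on, all iterates stay in the n-th box. Strong induction handles
  -- arbitrarily old reads when n = 0.
  have key : ∀ n : ℕ, ∃ K, ∀ k, K ≤ k → ∀ i g, ‖e k i g‖ ≤ θ ^ n * C₀ * w g := by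
    intro n
    induction n with
    | zero =>
      refine ⟨0, fun k _ => ?_⟩
      induction k using Nat.strong_induction_on with
      | _ k ih =>
        intro i g
        rw [pow_zero, one_mul]
        rcases k with _ | k
        · exact hC' i g
        · by_cases hi : i ∈ P k
          · rw [(he k i).1 hi]
            refine (hF C₀ _ hC0 (fun j g => ?_) g).trans ?_
            · simpa using ih (τ i j k) (Nat.lt_succ_of_le (hτ i j k)) (Nat.zero_le _) j g
            · exact mul_le_mul_of_nonneg_right (mul_le_of_le_one_left hC0 hθ1.le) (hw g).le
          · rw [(he k i).2 hi]
            simpa using ih k (Nat.lt_succ_self k) (Nat.zero_le _) i g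
    | succ n ih =>
      obtain ⟨K, hK⟩ := ih
      have hev : ∀ᶠ k in atTop, ∀ i j, K ≤ τ i j k :=
        eventually_all.2 fun i => eventually_all.2 fun j => (hτlim i j).eventually_ge_atTop K
      obtain ⟨K', hK'⟩ := eventually_atTop.1 hev
      have hupd : ∀ k, K' ≤ k → ∀ i, i ∈ P k → ∀ g,
          ‖e (k + 1) i g‖ ≤ θ ^ (n + 1) * C₀ * w g := by
        intro k hk i hi g
        rw [(he k i).1 hi, pow_succ', mul_assoc θ]
        exact hF _ _ (mul_nonneg (pow_nonneg hθ0 n) hC0)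
          (fun j g => hK _ (hK' k hk i j) j g) g
      -- Once all reads come from the n-th box, process i enters the next box at its first chosen
      -- update, that is at time s i + 1, and never leaves it.
      choose s hsP hsK using fun i => (hP i).exists_gt K'
      obtain ⟨L, hL⟩ := Finite.exists_le s
      have hafter : ∀ i k, s i + 1 ≤ k → ∀ g, ‖e k i g‖ ≤ θ ^ (n + 1) * C₀ * w g := by
        intro i k hk
        induction k, hk using Nat.le_induction with
        | base => exact hupd (s i) (hsK i).le i (hsP i)
        | succ k hk ih =>
          by_cases hi : i ∈ P k
          · exact hupd k (by have := hsK i; omega) i hi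
          · rw [(he k i).2 hi]
            exact ih
      exact ⟨L + 1, fun k hk i => hafter i k (by have := hL i; omega)⟩
  rw [tendsto_pi_nhds]
  intro g
  rw [Pi.zero_apply, Metric.tendsto_atTop]
  intro ε hε
  have hlim : Tendsto (fun n : ℕ => θ ^ n * C₀ * w g) atTop (𝓝 0) := by
    simpa using
      ((tendsto_pow_atTop_nhds_zero_of_lt_one hθ0 hθ1).mul_const C₀).mul_const (w g)
  obtain ⟨n, hn⟩ := (hlim.eventually (gt_mem_nhds hε)).exists
  obtain ⟨K, hK⟩ := key n
  refine ⟨K, fun k hk => ?_⟩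
  rw [dist_zero_right]
  exact (hK k hk i g).trans_lt hn

/-! ### Contraction for the primal Schur method -/

namespace DDSystem

variable {𝕜 ι Γ : Type*} {N : ι → Type*} [RCLike 𝕜] [Fintype ι]
  [∀ i, Fintype (N i)] [∀ i, DecidableEq (N i)] [Fintype Γ] [DecidableEq Γ]

/-- The linear part `z ↦ ∑ j, (E j - M⁻¹ S^(j)) z j` of one update of the asynchronous method. -/
noncomputable def updateLinear (D : DDSystem 𝕜 ι N Γ) (E : ι → Matrix Γ Γ 𝕜) (M : Matrix Γ Γ 𝕜)
    (z : ι → Γ → 𝕜) : Γ → 𝕜 :=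
  ∑ j, (E j *ᵥ z j - M⁻¹ *ᵥ (D.localSchur j *ᵥ z j))

/-- Positive weights for which the global matrix of an H-matrix system is row dominant, split into
interior and interface rows. -/
theorem exists_weights [DecidableEq ι] (D : DDSystem 𝕜 ι N Γ) (hH : IsHMatrix D.globalMatrix) :
    ∃ (u : ∀ i, N i → ℝ) (w : Γ → ℝ), (∀ i r, 0 < u i r) ∧ (∀ g, 0 < w g) ∧
      (∀ i r, ∑ s, ‖D.AII i r s‖ * u i s + ∑ g, ‖D.AIΓ i r g‖ * w g
        < 2 * ‖D.AII i r r‖ * u i r) ∧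
      ∀ g, ∑ i, ∑ s, ‖D.AΓI i g s‖ * u i s + ∑ h, ‖D.interfaceBlock g h‖ * w h
        < 2 * ‖D.interfaceBlock g g‖ * w g := by
  obtain ⟨v, hv, hAv⟩ := IsMMatrix.exists_pos_mulVec_pos hH
  refine ⟨fun i r => v (Sum.inl ⟨i, r⟩), fun g => v (Sum.inr g), fun _ _ => hv _, fun _ => hv _,
    fun i r => ?_, fun g => ?_⟩
  · have h := hAv (Sum.inl ⟨i, r⟩)
    rw [comparison_mulVec_apply, Fintype.sum_sum_type, Fintype.sum_sigma,
      Finset.sum_eq_single i] at h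
    · simpa [globalMatrix, Matrix.blockDiagonal'_apply_eq] using h
    · intro k _ hk
      refine Finset.sum_eq_zero fun s _ => ?_
      simp [globalMatrix, Matrix.blockDiagonal'_apply_ne _ _ _ hk.symm]
    · exact fun h => absurd (Finset.mem_univ i) h
  · have h := hAv (Sum.inr g)
    rw [comparison_mulVec_apply, Fintype.sum_sum_type, Fintype.sum_sigma] at h
    simpa [globalMatrix] using h

/-- Bound on `|m_g|` times the `g`-th entry of the linear part of an update. -/
theorem norm_mul_updateLinear_le (D : DDSystem 𝕜 ι N Γ) {E : ι → Matrix Γ Γ 𝕜}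
    (hE : ∑ i, E i = 1) {W : ι → Matrix Γ Γ ℝ} (hW : ∀ i g h, 0 ≤ W i g h)
    (hWA : ∀ i, D.AΓΓ i = Matrix.hadamard ((W i).map (fun t : ℝ => (t : 𝕜))) D.interfaceBlock)
    (hWE : ∀ i, E i = Matrix.hadamard ((W i).map (fun t : ℝ => (t : 𝕜))) (1 : Matrix Γ Γ 𝕜))
    {u : ∀ i, N i → ℝ} {w : Γ → ℝ} (hu : ∀ i r, 0 < u i r) (hw : ∀ g, 0 < w g)
    (hI : ∀ i r, ∑ s, ‖D.AII i r s‖ * u i s + ∑ g, ‖D.AIΓ i r g‖ * w g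
        < 2 * ‖D.AII i r r‖ * u i r)
    (hAII : ∀ i, IsUnit (D.AII i)) {m : Γ → 𝕜} (hm : ∀ g, m g ≠ 0)
    {c : ℝ} (hc : 0 ≤ c) {z : ι → Γ → 𝕜} (hz : ∀ j g, ‖z j g‖ ≤ c * w g) (g : Γ) :
    ‖m g‖ * ‖D.updateLinear E (Matrix.diagonal m) z g‖ ≤
      c * (∑ h, ‖(Matrix.diagonal m - D.interfaceBlock) g h‖ * w h
        + ∑ j, ∑ s, ‖D.AΓI j g s‖ * u j s) := by
  set A := D.interfaceBlock with hA
  have hWsumE : ∀ g, ∑ j, W j g g = 1 := by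
    intro g
    have h := congrFun (congrFun hE g) g
    simp only [Matrix.sum_apply, hWE, Matrix.hadamard_apply, Matrix.map_apply,
      Matrix.one_apply_eq, mul_one] at h
    exact_mod_cast h
  have hWsumA : ∀ g h, A g h ≠ 0 → ∑ j, W j g h = 1 := by
    intro g h hgh
    have h1 : ∑ j, D.AΓΓ j g h = A g h := by
      rw [hA, interfaceBlock, Matrix.sum_apply]
    simp only [hWA, Matrix.hadamard_apply, Matrix.map_apply, ← Finset.sum_mul] at h1
    have h2 := mul_right_cancel₀ hgh (h1.trans (one_mul _).symm)
    exact_mod_cast h2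
  -- The weights need not sum to one where A vanishes off the diagonal, but there the diagonal
  -- matrix minus A vanishes too.
  have hWsum : ∀ h, (∑ j, W j g h) * ‖(Matrix.diagonal m - A) g h‖
      = ‖(Matrix.diagonal m - A) g h‖ := by
    intro h
    by_cases hgh : g = h
    · subst hgh
      rw [hWsumE, one_mul]
    · by_cases h0 : A g h = 0
      · simp [Matrix.diagonal_apply_ne _ hgh, h0]
      · rw [hWsumA g h h0, one_mul]
  have hinv : (Matrix.diagonal m)⁻¹ = Matrix.diagonal fun g => (m g)⁻¹ := by
    refine Matrix.inv_eq_right_inv ?_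
    rw [Matrix.diagonal_mul_diagonal, ← Matrix.diagonal_one]
    exact congrArg _ (funext fun g => mul_inv_cancel₀ (hm g))
  set v : ∀ j, N j → 𝕜 := fun j => (D.AII j)⁻¹ *ᵥ (D.AIΓ j *ᵥ z j) with hvdef
  have hv : ∀ j s, ‖v j s‖ ≤ c * u j s := by
    intro j
    refine norm_le_of_norm_mulVec_le (hu j)
      (fun r => Finset.sum_nonneg fun g _ => mul_nonneg (norm_nonneg _) (hw g).le)
      (hI j) hc fun r => ?_
    rw [hvdef, Matrix.mulVec_mulVec,
      Matrix.mul_nonsing_inv _ ((Matrix.isUnit_iff_isUnit_det _).1 (hAII j)), Matrix.one_mulVec]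
    simp only [Matrix.mulVec, dotProduct]
    refine (norm_sum_le _ _).trans ?_
    rw [Finset.mul_sum]
    refine Finset.sum_le_sum fun h _ => ?_
    rw [norm_mul, mul_left_comm]
    exact mul_le_mul_of_nonneg_left (hz j h) (norm_nonneg _)
  have hterm : ∀ j, m g * (E j *ᵥ z j - (Matrix.diagonal m)⁻¹ *ᵥ (D.localSchur j *ᵥ z j)) g
      = ∑ h, (W j g h : 𝕜) * (Matrix.diagonal m - A) g h * z j h
        + ∑ s, D.AΓI j g s * v j s := by
    intro j
    have hS : (D.localSchur j *ᵥ z j) g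
        = ∑ h, (W j g h : 𝕜) * A g h * z j h - ∑ s, D.AΓI j g s * v j s := by
      rw [localSchur, Matrix.sub_mulVec, ← Matrix.mulVec_mulVec, ← Matrix.mulVec_mulVec,
        Pi.sub_apply, hWA j]
      rfl
    have hEz : m g * (E j *ᵥ z j) g
        = ∑ h, (W j g h : 𝕜) * Matrix.diagonal m g h * z j h := by
      rw [hWE j]
      simp only [Matrix.mulVec, dotProduct, Matrix.hadamard_apply, Matrix.map_apply,
        Finset.mul_sum]
      refine Finset.sum_congr rfl fun h _ => ?_
      by_cases hgh : g = h
      · subst hgh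
        rw [Matrix.one_apply_eq, Matrix.diagonal_apply_eq]
        ring
      · rw [Matrix.one_apply_ne hgh, Matrix.diagonal_apply_ne _ hgh]
        ring
    rw [Pi.sub_apply, mul_sub, hEz, hinv, Matrix.mulVec_diagonal, mul_inv_cancel_left₀ (hm g),
      hS, ← sub_add, ← Finset.sum_sub_distrib]
    simp only [Matrix.sub_apply, mul_sub, sub_mul]
  have hbound : ∀ j,
      ‖m g * (E j *ᵥ z j - (Matrix.diagonal m)⁻¹ *ᵥ (D.localSchur j *ᵥ z j)) g‖
        ≤ ∑ h, W j g h * ‖(Matrix.diagonal m - A) g h‖ * (c * w h)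
          + ∑ s, ‖D.AΓI j g s‖ * (c * u j s) := by
    intro j
    rw [hterm]
    refine (norm_add_le _ _).trans (add_le_add ((norm_sum_le _ _).trans ?_)
      ((norm_sum_le _ _).trans ?_))
    · refine Finset.sum_le_sum fun h _ => ?_
      rw [norm_mul, norm_mul, RCLike.norm_ofReal, abs_of_nonneg (hW j g h)]
      exact mul_le_mul_of_nonneg_left (hz j h) (mul_nonneg (hW j g h) (norm_nonneg _))
    · refine Finset.sum_le_sum fun s _ => ?_
      rw [norm_mul]
      exact mul_le_mul_of_nonneg_left (hv j s) (norm_nonneg _)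
  rw [← norm_mul, updateLinear, Finset.sum_apply, Finset.mul_sum]
  refine (norm_sum_le _ _).trans ((Finset.sum_le_sum fun j _ => hbound j).trans_eq ?_)
  rw [Finset.sum_add_distrib, mul_add, Finset.sum_comm]
  congr 1
  · rw [Finset.mul_sum]
    refine Finset.sum_congr rfl fun h _ => ?_
    rw [← Finset.sum_mul, ← Finset.sum_mul, hWsum]
    ring
  · simp only [Finset.mul_sum]
    exact Finset.sum_congr rfl fun j _ => Finset.sum_congr rfl fun s _ => by ring

/-- The method converges once the linear part of an update contracts a weighted supremum norm. -/
theorem asyncSchurConverges_of_contraction (D : DDSystem 𝕜 ι N Γ) {E : ι → Matrix Γ Γ 𝕜}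
    (hE : ∑ i, E i = 1) {M : Matrix Γ Γ 𝕜} {w : Γ → ℝ} (hw : ∀ g, 0 < w g) {θ : ℝ}
    (hθ0 : 0 ≤ θ) (hθ1 : θ < 1)
    (hF : ∀ (c : ℝ) (z : ι → Γ → 𝕜), 0 ≤ c → (∀ j g, ‖z j g‖ ≤ c * w g) →
      ∀ g, ‖D.updateLinear E M z g‖ ≤ θ * c * w g) :
    D.AsyncSchurConverges E M := by
  have hconst : ∀ z : Γ → 𝕜, D.updateLinear E M (fun _ => z)
      = z - M⁻¹ *ᵥ ((∑ i, D.localSchur i) *ᵥ z) := by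
    intro z
    rw [updateLinear, Finset.sum_sub_distrib, ← Matrix.sum_mulVec, hE, Matrix.one_mulVec,
      ← Matrix.mulVec_sum, ← Matrix.sum_mulVec]
  -- A kernel vector, copied to every process, is fixed by the contraction, hence zero.
  have hinj : Function.Injective (∑ i, D.localSchur i).mulVec := by
    refine (injective_iff_map_eq_zero (∑ i, D.localSchur i).mulVecLin).2 fun z hz => ?_
    have hz' : D.updateLinear E M (fun _ => z) = z := by
      rw [hconst, show (∑ i, D.localSchur i) *ᵥ z = 0 from hz, Matrix.mulVec_zero, sub_zero]
    obtain ⟨C, hC⟩ := Finite.exists_le fun g => ‖z g‖ / w g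
    have hall : ∀ n : ℕ, ∀ g, ‖z g‖ ≤ θ ^ n * max C 0 * w g := by
      intro n
      induction n with
      | zero =>
        intro g
        rw [pow_zero, one_mul]
        exact (div_le_iff₀ (hw g)).1 ((hC g).trans (le_max_left _ _))
      | succ n ih =>
        intro g
        rw [pow_succ', mul_assoc θ, ← hz']
        exact hF _ _ (mul_nonneg (pow_nonneg hθ0 n) (le_max_right _ _)) (fun _ => ih) g
    funext g
    have hlim : Tendsto (fun n : ℕ => θ ^ n * max C 0 * w g) atTop (𝓝 0) := by
      simpa using
        ((tendsto_pow_atTop_nhds_zero_of_lt_one hθ0 hθ1).mul_const (max C 0)).mul_const (w g)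
    exact norm_le_zero_iff.1 (ge_of_tendsto' hlim fun n => hall n g)
  have hunit : IsUnit (∑ i, D.localSchur i).det :=
    (Matrix.isUnit_iff_isUnit_det _).1 (Matrix.mulVec_injective_iff_isUnit.1 hinj)
  set xstar := (∑ i, D.localSchur i)⁻¹ *ᵥ ∑ i, D.localRhs i with hx
  have hsol : (∑ i, D.localSchur i) *ᵥ xstar = ∑ i, D.localRhs i := by
    rw [hx, Matrix.mulVec_mulVec, Matrix.mul_nonsing_inv _ hunit, Matrix.one_mulVec]
  refine ⟨xstar, fun z => ⟨fun hz => hinj (hz.trans hsol.symm), fun hz => hz ▸ hsol⟩, ?_⟩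
  intro P τ x hPτ hiter i
  have hmsg : ∀ z : ι → Γ → 𝕜, ∑ j, D.message E M j (z j) - xstar
      = D.updateLinear E M fun j => z j - xstar := by
    intro z
    have h1 : ∑ j, D.message E M j (z j)
        = D.updateLinear E M z + M⁻¹ *ᵥ ∑ j, D.localRhs j := by
      rw [updateLinear, Matrix.mulVec_sum, ← Finset.sum_add_distrib]
      refine Finset.sum_congr rfl fun j _ => ?_
      rw [message, Matrix.mulVec_sub]
      abel
    have h2 : (D.updateLinear E M fun j => z j - xstar)
        = D.updateLinear E M z - D.updateLinear E M fun _ => xstar := by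
      simp only [updateLinear, ← Finset.sum_sub_distrib]
      refine Finset.sum_congr rfl fun j _ => ?_
      simp only [Matrix.mulVec_sub]
      abel
    rw [h1, h2, hconst, hsol]
    abel
  have hlim := tendsto_zero_of_async_contraction (F := D.updateLinear E M) hw hθ0 hθ1 hF hPτ
    (e := fun k i => x k i - xstar) (fun k i => ⟨fun hi => by
      rw [(hiter k i).1 hi, hmsg fun j => x (τ i j k) j], fun hi => by
      rw [(hiter k i).2 hi]⟩) i
  simpa using hlim.add_const xstar

/-- Convergence for a diagonal preconditioner compatible with the interface block. -/
theorem asyncSchurConverges_of_isDiag (D : DDSystem 𝕜 ι N Γ) {E : ι → Matrix Γ Γ 𝕜}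
    (hE : ∑ i, E i = 1) {W : ι → Matrix Γ Γ ℝ} (hW : ∀ i g h, 0 ≤ W i g h)
    (hWA : ∀ i, D.AΓΓ i = Matrix.hadamard ((W i).map (fun t : ℝ => (t : 𝕜))) D.interfaceBlock)
    (hWE : ∀ i, E i = Matrix.hadamard ((W i).map (fun t : ℝ => (t : 𝕜))) (1 : Matrix Γ Γ 𝕜))
    {u : ∀ i, N i → ℝ} {w : Γ → ℝ} (hu : ∀ i r, 0 < u i r) (hw : ∀ g, 0 < w g)
    (hI : ∀ i r, ∑ s, ‖D.AII i r s‖ * u i s + ∑ g, ‖D.AIΓ i r g‖ * w g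
        < 2 * ‖D.AII i r r‖ * u i r)
    (hG : ∀ g, ∑ i, ∑ s, ‖D.AΓI i g s‖ * u i s + ∑ h, ‖D.interfaceBlock g h‖ * w h
        < 2 * ‖D.interfaceBlock g g‖ * w g)
    (hAII : ∀ i, IsUnit (D.AII i)) {M : Matrix Γ Γ 𝕜} (hM : M.IsDiag)
    (hcomp : comparison M - absMatrix (M - D.interfaceBlock) = comparison D.interfaceBlock) :
    IsUnit M ∧ D.AsyncSchurConverges E M := by
  obtain ⟨m, rfl⟩ : ∃ m, M = Matrix.diagonal m := ⟨M.diag, hM.diagonal_diag.symm⟩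
  -- The comparison identity applied to w, combined with interface dominance. Strictness also forces
  -- each m g to be nonzero.
  have hrow : ∀ g, ∑ h, ‖(Matrix.diagonal m - D.interfaceBlock) g h‖ * w h
      + ∑ j, ∑ s, ‖D.AΓI j g s‖ * u j s < ‖m g‖ * w g := by
    intro g
    have h1 := congrFun (congrArg (fun B => B *ᵥ w) hcomp) g
    simp only [Matrix.sub_mulVec, Pi.sub_apply, comparison_mulVec_apply] at h1
    have h2 : ∑ h, ‖Matrix.diagonal m g h‖ * w h = ‖m g‖ * w g := by
      rw [Finset.sum_eq_single g]
      · rw [Matrix.diagonal_apply_eq]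
      · intro h _ hne
        rw [Matrix.diagonal_apply_ne _ hne.symm, norm_zero, zero_mul]
      · exact fun h => absurd (Finset.mem_univ g) h
    have h3 : (absMatrix (Matrix.diagonal m - D.interfaceBlock) *ᵥ w) g
        = ∑ h, ‖(Matrix.diagonal m - D.interfaceBlock) g h‖ * w h := rfl
    rw [h2, h3, Matrix.diagonal_apply_eq] at h1
    linarith [hG g]
  have hpos : ∀ g, 0 < ‖m g‖ * w g := fun g =>
    (add_nonneg (Finset.sum_nonneg fun h _ => mul_nonneg (norm_nonneg _) (hw h).le)
      (Finset.sum_nonneg fun j _ => Finset.sum_nonneg fun s _ =>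
        mul_nonneg (norm_nonneg _) (hu j s).le)).trans_lt (hrow g)
  have hmpos : ∀ g, 0 < ‖m g‖ := fun g => pos_of_mul_pos_left (hpos g) (hw g).le
  have hm : ∀ g, m g ≠ 0 := fun g => norm_pos_iff.1 (hmpos g)
  refine ⟨Matrix.isUnit_diagonal.2 (Pi.isUnit_iff.2 fun g => (hm g).isUnit), ?_⟩
  -- There are finitely many interface rows, so one θ < 1 serves all.
  have hev : ∀ᶠ θ in 𝓝[<] (1 : ℝ), ∀ g,
      (∑ h, ‖(Matrix.diagonal m - D.interfaceBlock) g h‖ * w h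
        + ∑ j, ∑ s, ‖D.AΓI j g s‖ * u j s) / (‖m g‖ * w g) < θ :=
    eventually_all.2 fun g => mem_nhdsWithin_of_mem_nhds
      (lt_mem_nhds ((div_lt_one (hpos g)).2 (hrow g)))
  obtain ⟨θ, ⟨hθ, hθ0⟩, hθ1⟩ := ((hev.and (mem_nhdsWithin_of_mem_nhds
    (lt_mem_nhds (zero_lt_one (α := ℝ))))).and self_mem_nhdsWithin).exists
  refine D.asyncSchurConverges_of_contraction hE hw (le_of_lt hθ0) hθ1 fun c z hc hz g => ?_
  have h1 := D.norm_mul_updateLinear_le hE hW hWA hWE hu hw hI hAII hm hc hz g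
  have h2 := mul_le_mul_of_nonneg_left ((div_lt_iff₀ (hpos g)).1 (hθ g)).le hc
  refine le_of_mul_le_mul_left ((h1.trans h2).trans_eq ?_) (hmpos g)
  ring

end DDSystem

/-- On the diagonal α|a| - |α - 1||a| = |a|, because α ≥ 1; off it, only -|a| remains. -/
theorem comparison_smul_diagonal_sub {n 𝕜 : Type*} [DecidableEq n] [RCLike 𝕜]
    (A : Matrix n n 𝕜) {α : ℝ} (hα : 1 ≤ α) :
    comparison ((α : 𝕜) • Matrix.diagonal A.diag)
      - absMatrix ((α : 𝕜) • Matrix.diagonal A.diag - A) = comparison A := by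
  ext g h
  simp only [comparison, absMatrix, Matrix.sub_apply, Matrix.of_apply, Matrix.map_apply,
    Matrix.smul_apply, smul_eq_mul]
  by_cases hgh : g = h
  · subst hgh
    have h1 : (α : 𝕜) * A g g - A g g = ((α - 1 : ℝ) : 𝕜) * A g g := by
      push_cast
      ring
    rw [Matrix.diagonal_apply_eq, Matrix.diag_apply, if_pos rfl, if_pos rfl, h1, norm_mul,
      norm_mul, RCLike.norm_ofReal, RCLike.norm_ofReal, abs_of_nonneg (by linarith),
      abs_of_nonneg (by linarith)]
    ring
  · simp [hgh]

end AsyncSchur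

theorem mainTheorem4 {𝕜 ι Γ : Type*} {N : ι → Type*} [RCLike 𝕜]
    [Fintype ι] [DecidableEq ι] [∀ i, Fintype (N i)] [∀ i, DecidableEq (N i)]
    [Fintype Γ] [DecidableEq Γ]
    (D : AsyncSchur.DDSystem 𝕜 ι N Γ)
    (E : ι → Matrix Γ Γ 𝕜) (hE : ∑ i, E i = 1)
    (W : ι → Matrix Γ Γ ℝ) (hW : ∀ i g h, 0 ≤ W i g h)
    (hWA : ∀ i, D.AΓΓ i = Matrix.hadamard ((W i).map (fun t : ℝ => (t : 𝕜))) D.interfaceBlock)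
    (hWE : ∀ i, E i = Matrix.hadamard ((W i).map (fun t : ℝ => (t : 𝕜))) (1 : Matrix Γ Γ 𝕜))
    (hH : AsyncSchur.IsHMatrix D.globalMatrix) :
    (∀ i, IsUnit (D.AII i)) ∧
    (∀ M : Matrix Γ Γ 𝕜, M.IsDiag →
      AsyncSchur.comparison M - AsyncSchur.absMatrix (M - D.interfaceBlock)
        = AsyncSchur.comparison D.interfaceBlock →
      IsUnit M ∧ D.AsyncSchurConverges E M) ∧
    (∀ α : ℝ, 1 ≤ α → ∀ M : Matrix Γ Γ 𝕜,
      M = (α : 𝕜) • Matrix.diagonal D.interfaceBlock.diag →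
      M.IsDiag ∧
      AsyncSchur.comparison M - AsyncSchur.absMatrix (M - D.interfaceBlock)
        = AsyncSchur.comparison D.interfaceBlock ∧
      IsUnit M ∧ D.AsyncSchurConverges E M) := by
  obtain ⟨u, w, hu, hw, hI, hG⟩ := D.exists_weights hH
  have hAII : ∀ i, IsUnit (D.AII i) := fun i =>
    AsyncSchur.isUnit_of_dominant (hu i) fun r => lt_of_le_of_lt
      (le_add_of_nonneg_right
        (Finset.sum_nonneg fun g _ => mul_nonneg (norm_nonneg _) (hw g).le)) (hI i r)
  have hconv := fun (M : Matrix Γ Γ 𝕜) (hM : M.IsDiag) =>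
    D.asyncSchurConverges_of_isDiag hE hW hWA hWE hu hw hI hG hAII hM
  refine ⟨hAII, hconv, ?_⟩
  rintro α hα M rfl
  have hdiag := (Matrix.isDiag_diagonal D.interfaceBlock.diag).smul (α : 𝕜)
  have hcomp := AsyncSchur.comparison_smul_diagonal_sub D.interfaceBlock hα
  exact ⟨hdiag, hcomp, hconv _ hdiag hcomp⟩
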